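/- Let $H_1, H_2$ be complex Hilbert spaces, not necessarily separable, and let $T\colon H_1\to H_2$ be a bounded linear operator. For a bounded linear operator $S\colon E\to F$ between complex Hilbert spaces with $E \neq \{0\}$, let $m(S)=\inf\{\|Sx\| : x\in E,\ \|x\|=1\}$ be its minimum modulus, and call $S$ minimum attaining if there is $x_0\in E$ with $\|x_0\|=1$ and $\|Sx_0\|=m(S)$. Call a bounded linear operator $S\colon E\to F$ absolutely minimum attaining if the restriction $S|_M\colon M\to F$ is minimum attaining for every nonzero closed subspace $M$ of $E$. Let $\mathcal{AM}(H_1,H_2)$ be the set of absolutely minimum attaining operators from $H_1$ to $H_2$, and let $\mathcal{AM}^+(H_1)$ be the set of positive (self-adjoint with $\langle Sx,x\rangle\ge 0$ for all $x$) absolutely minimum attaining operators $S$ on $H_1$. Let $|T|=(T^*T)^{1/2}$ be the unique positive square root of $T^*T$. Then the following statements are equivalent: 1. $T\in\mathcal{AM}(H_1,H_2)$; 2. $|T|\in\mathcal{AM}^+(H_1)$; 3. $T^*T\in\mathcal{AM}^+(H_1)$. -/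

import Mathlib

namespace AbsMin

/-- The minimum modulus `m(T) = inf {‖T x‖ : ‖x‖ = 1}`. -/
noncomputable def minModulus {E F : Type*}
    [NormedAddCommGroup E] [NormedSpace ℂ E] [NormedAddCommGroup F] [NormedSpace ℂ F]
    (T : E →L[ℂ] F) : ℝ :=
  sInf ((fun x => ‖T x‖) '' Metric.sphere (0 : E) 1)

/-- `T` is minimum attaining: some unit vector `x₀` satisfies `m(T) = ‖T x₀‖`. -/
def IsMinAttaining {E F : Type*}
    [NormedAddCommGroup E] [NormedSpace ℂ E] [NormedAddCommGroup F] [NormedSpace ℂ F]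
    (T : E →L[ℂ] F) : Prop :=
  ∃ x₀ : E, ‖x₀‖ = 1 ∧ minModulus T = ‖T x₀‖

/-- `T` is absolutely minimum attaining: the restriction `T|_M : M → F` is minimum attaining
for every nonzero closed subspace `M` of `E`. -/
def IsAbsMinAttaining {E F : Type*}
    [NormedAddCommGroup E] [NormedSpace ℂ E] [NormedAddCommGroup F] [NormedSpace ℂ F]
    (T : E →L[ℂ] F) : Prop :=
  ∀ M : Submodule ℂ E, IsClosed (M : Set E) → M ≠ ⊥ → IsMinAttaining (T ∘L M.subtypeL)

/-- The class `AM(H₁, H₂)` of absolutely minimum attaining operators. -/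
def AM (H₁ H₂ : Type*)
    [NormedAddCommGroup H₁] [InnerProductSpace ℂ H₁]
    [NormedAddCommGroup H₂] [InnerProductSpace ℂ H₂] : Set (H₁ →L[ℂ] H₂) :=
  {T | IsAbsMinAttaining T}

/-- The class `AM⁺(H)` of positive absolutely minimum attaining operators on `H`. -/
def AMPlus (H : Type*) [NormedAddCommGroup H] [InnerProductSpace ℂ H] : Set (H →L[ℂ] H) :=
  {T | T ∈ AM H H ∧ T.IsPositive}

/-- The modulus `|T| = (T*T)^{1/2}`, an operator on `H₁`. -/
noncomputable def modulus {H₁ H₂ : Type*}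
    [NormedAddCommGroup H₁] [InnerProductSpace ℂ H₁] [CompleteSpace H₁]
    [NormedAddCommGroup H₂] [InnerProductSpace ℂ H₂] [CompleteSpace H₂]
    (T : H₁ →L[ℂ] H₂) : H₁ →L[ℂ] H₁ :=
  CFC.sqrt (ContinuousLinearMap.adjoint T ∘L T)

/-- The modulus is the unique positive square root of `T*T`. -/
theorem eq_modulus_iff {H₁ H₂ : Type*}
    [NormedAddCommGroup H₁] [InnerProductSpace ℂ H₁] [CompleteSpace H₁]
    [NormedAddCommGroup H₂] [InnerProductSpace ℂ H₂] [CompleteSpace H₂]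
    (T : H₁ →L[ℂ] H₂) (S : H₁ →L[ℂ] H₁) :
    S = modulus T ↔ S.IsPositive ∧ S ∘L S = ContinuousLinearMap.adjoint T ∘L T := by
  have hT : 0 ≤ ContinuousLinearMap.adjoint T ∘L T :=
    (ContinuousLinearMap.nonneg_iff_isPositive _).2
      (ContinuousLinearMap.isPositive_adjoint_comp_self T)
  constructor
  · rintro rfl
    exact ⟨(ContinuousLinearMap.nonneg_iff_isPositive _).1 (CFC.sqrt_nonneg _),
      CFC.sqrt_mul_sqrt_self _ hT⟩
  · rintro ⟨hS, h⟩
    exact (CFC.sqrt_unique h ((ContinuousLinearMap.nonneg_iff_isPositive _).2 hS)).symm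

end AbsMin

/-! Since `‖T x‖² = ⟨T*T x, x⟩`, both `T` and `|T|` are absolutely minimum attaining exactly when
the form of `T*T` attains its minimum on the unit sphere of every nonzero closed subspace. For `T*T`
itself the form is that of `(T*T)²`, so everything reduces to comparing a positive `A` with `A²`
(`formAttaining_mul_self_iff`).

The comparison goes through a criterion stable under squaring: the form of `A` is attaining iff, for
some `β ≥ 0`, `A - β` is compact and `A ≤ β` on a subspace of finite codimension
(`formAttaining_iff_exists_isEssScalarFromBelow`). Infima below `β` are then attained by
compactness. If no such `β` exists, an orthonormal sequence with strictly decreasing diagonal values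
spans a bad subspace. Squaring preserves the criterion because `A² - β² = (A - β)(A + β)` is `A - β`
conjugated by `√(A + β)`. -/

namespace AbsMin

open ContinuousLinearMap Module

/-! ### Quadratic forms and minimum attainment. -/

section Defs

variable {E F : Type*} [NormedAddCommGroup E] [InnerProductSpace ℂ E]
  [NormedAddCommGroup F] [InnerProductSpace ℂ F]

/-- The quadratic form of `A` attains its minimum on the unit sphere of every nonzero closed
subspace. -/
def FormAttaining (A : E →L[ℂ] E) : Prop :=
  ∀ M : Submodule ℂ E, IsClosed (M : Set E) → M ≠ ⊥ → ∃ x₀ ∈ M, ‖x₀‖ = 1 ∧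
    ∀ x ∈ M, ‖x‖ = 1 → A.reApplyInnerSelf x₀ ≤ A.reApplyInnerSelf x

/-- `A` is a compact perturbation of `β`, and `A ≤ β` on a subspace of finite codimension. -/
def IsEssScalarFromBelow (A : E →L[ℂ] E) (β : ℝ) : Prop :=
  IsCompactOperator (A - (β : ℂ) • (1 : E →L[ℂ] E)) ∧
    ∃ W : Submodule ℂ E, FiniteDimensional ℂ W ∧
      ∀ x ∈ Wᗮ, (A - (β : ℂ) • (1 : E →L[ℂ] E)).reApplyInnerSelf x ≤ 0

theorem isAbsMinAttaining_iff (T : E →L[ℂ] F) :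
    IsAbsMinAttaining T ↔ ∀ M : Submodule ℂ E, IsClosed (M : Set E) → M ≠ ⊥ →
      ∃ x₀ ∈ M, ‖x₀‖ = 1 ∧ ∀ x ∈ M, ‖x‖ = 1 → ‖T x₀‖ ≤ ‖T x‖ := by
  refine forall₃_congr fun M _ _ => ?_
  have hbdd : BddBelow ((fun x => ‖(T ∘L M.subtypeL) x‖) '' Metric.sphere (0 : M) 1) :=
    ⟨0, by rintro _ ⟨x, _, rfl⟩; exact norm_nonneg _⟩
  constructor
  · rintro ⟨x₀, h₀, h⟩
    refine ⟨x₀, x₀.2, h₀, fun x hx hx1 => ?_⟩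
    have : minModulus (T ∘L M.subtypeL) ≤ ‖(T ∘L M.subtypeL) ⟨x, hx⟩‖ :=
      csInf_le hbdd ⟨⟨x, hx⟩, by simpa using hx1, rfl⟩
    rw [h] at this
    simpa using this
  · rintro ⟨x₀, hx₀, h₀, h⟩
    refine ⟨⟨x₀, hx₀⟩, h₀, le_antisymm (csInf_le hbdd ⟨⟨x₀, hx₀⟩, by simpa using h₀, rfl⟩) ?_⟩
    refine le_csInf ⟨_, ⟨⟨x₀, hx₀⟩, by simpa using h₀, rfl⟩⟩ ?_
    rintro _ ⟨x, hx, rfl⟩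
    exact h x x.2 (by simpa using hx)

theorem isAbsMinAttaining_iff_formAttaining [CompleteSpace E] [CompleteSpace F] (T : E →L[ℂ] F) :
    IsAbsMinAttaining T ↔ FormAttaining (adjoint T ∘L T) := by
  rw [isAbsMinAttaining_iff]
  have key (x : E) : (adjoint T ∘L T).reApplyInnerSelf x = ‖T x‖ ^ 2 :=
    (T.apply_norm_sq_eq_inner_adjoint_left x).symm
  simp only [FormAttaining, key, sq_le_sq₀ (norm_nonneg _) (norm_nonneg _)]

theorem reApplyInnerSelf_sub_smul_one (A : E →L[ℂ] E) (β : ℝ) (x : E) :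
    (A - (β : ℂ) • (1 : E →L[ℂ] E)).reApplyInnerSelf x = A.reApplyInnerSelf x - β * ‖x‖ ^ 2 := by
  simp only [reApplyInnerSelf_apply, sub_apply, smul_apply, one_apply_eq_self, inner_sub_left,
    inner_smul_left, map_sub, Complex.conj_ofReal]
  congr 1
  rw [RCLike.re_eq_complex_re, Complex.re_ofReal_mul, ← RCLike.re_eq_complex_re,
    inner_self_eq_norm_sq]

theorem exists_unit_mem {M : Submodule ℂ E} (hM : M ≠ ⊥) : ∃ x ∈ M, ‖x‖ = 1 := by
  obtain ⟨x, hx, h0⟩ := M.ne_bot_iff.1 hM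
  exact ⟨((‖x‖⁻¹ : ℝ) : ℂ) • x, M.smul_mem _ hx, by simp [norm_smul, h0]⟩

theorem le_reApplyInnerSelf_of_unit {A : E →L[ℂ] E} {M : Submodule ℂ E} {m : ℝ}
    (h : ∀ x ∈ M, ‖x‖ = 1 → m ≤ A.reApplyInnerSelf x) {x : E} (hx : x ∈ M) :
    m * ‖x‖ ^ 2 ≤ A.reApplyInnerSelf x := by
  by_cases h0 : x = 0
  · simp [h0, reApplyInnerSelf_apply]
  have h1 := h (((‖x‖⁻¹ : ℝ) : ℂ) • x) (M.smul_mem _ hx) (by simp [norm_smul, h0])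
  rw [reApplyInnerSelf_smul] at h1
  have : 0 < ‖x‖ := norm_pos_iff.2 h0
  simp only [Complex.norm_real, norm_inv, norm_norm] at h1
  field_simp at h1
  exact h1

theorem reApplyInnerSelf_le_of_unit {A : E →L[ℂ] E} {M : Submodule ℂ E} {m : ℝ}
    (h : ∀ x ∈ M, ‖x‖ = 1 → A.reApplyInnerSelf x ≤ m) {x : E} (hx : x ∈ M) :
    A.reApplyInnerSelf x ≤ m * ‖x‖ ^ 2 := by
  by_cases h0 : x = 0
  · simp [h0, reApplyInnerSelf_apply]
  have h1 := h (((‖x‖⁻¹ : ℝ) : ℂ) • x) (M.smul_mem _ hx) (by simp [norm_smul, h0])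
  rw [reApplyInnerSelf_smul] at h1
  have : 0 < ‖x‖ := norm_pos_iff.2 h0
  simp only [Complex.norm_real, norm_inv, norm_norm] at h1
  field_simp at h1
  rwa [mul_comm] at h1

theorem norm_reApplyInnerSelf_le (A : E →L[ℂ] E) (x : E) :
    |A.reApplyInnerSelf x| ≤ ‖A‖ * ‖x‖ ^ 2 := by
  rw [reApplyInnerSelf_apply]
  calc _ ≤ ‖inner ℂ (A x) x‖ := RCLike.abs_re_le_norm _
    _ ≤ ‖A x‖ * ‖x‖ := norm_inner_le_norm _ _
    _ ≤ ‖A‖ * ‖x‖ * ‖x‖ := by gcongr; exact A.le_opNorm x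
    _ = _ := by ring

/-- Every value between two values of a quadratic form on the unit sphere of a subspace is
attained there. -/
theorem exists_unit_reApplyInnerSelf_eq (A : E →L[ℂ] E) {V : Submodule ℂ E} {x y : E} {c : ℝ}
    (hx : x ∈ V) (hy : y ∈ V) (hx1 : ‖x‖ = 1) (hy1 : ‖y‖ = 1)
    (hxc : A.reApplyInnerSelf x < c) (hyc : c < A.reApplyInnerSelf y) :
    ∃ z ∈ V, ‖z‖ = 1 ∧ A.reApplyInnerSelf z = c := by
  let γ : ℝ → E := fun t => ((1 - t : ℝ) : ℂ) • x + (t : ℂ) • y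
  have hγ : Continuous γ := by fun_prop
  let f : ℝ → ℝ := fun t => A.reApplyInnerSelf (γ t) - c * ‖γ t‖ ^ 2
  have hf : Continuous f := by
    have := A.reApplyInnerSelf_continuous.comp hγ
    exact this.sub (by fun_prop)
  have h0 : f 0 < 0 := by simp [f, γ, hx1, hxc]
  have h1 : 0 < f 1 := by simp [f, γ, hy1, hyc]
  obtain ⟨t, -, ht⟩ := intermediate_value_Icc zero_le_one hf.continuousOn ⟨h0.le, h1.le⟩
  -- Otherwise `x` and `y` differ by a unimodular scalar, and their form values coincide.
  have hne : γ t ≠ 0 := by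
    intro h
    have h2 : ((1 - t : ℝ) : ℂ) • x = (-t : ℂ) • y := by
      rw [neg_smul]; exact eq_neg_of_add_eq_zero_left h
    have h3 := congrArg A.reApplyInnerSelf h2
    have h4 := congrArg norm h2
    simp only [reApplyInnerSelf_smul, norm_smul, hx1, hy1, mul_one, norm_neg] at h3 h4
    rw [h4] at h3
    rcases eq_or_ne ‖(t : ℂ)‖ 0 with h5 | h5
    · rw [h5] at h4
      simp only [Complex.norm_real, norm_eq_zero] at h4 h5
      linarith
    · have := mul_left_cancel₀ (pow_ne_zero 2 h5) h3
      linarith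
  have hp : 0 < ‖γ t‖ := norm_pos_iff.2 hne
  refine ⟨((‖γ t‖⁻¹ : ℝ) : ℂ) • γ t, V.smul_mem _ (V.add_mem (V.smul_mem _ hx) (V.smul_mem _ hy)),
    by simp [norm_smul, hne], ?_⟩
  rw [reApplyInnerSelf_smul]
  have : A.reApplyInnerSelf (γ t) = c * ‖γ t‖ ^ 2 := sub_eq_zero.1 ht
  rw [this, Complex.norm_real, norm_inv, norm_norm]
  field_simp

end Defs

section Hilbert

variable {E : Type*} [NormedAddCommGroup E] [InnerProductSpace ℂ E] [CompleteSpace E]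

/-! ### Positive operators and compressions. -/

theorem exists_sq_eq_of_isPositive {C : E →L[ℂ] E} (hC : C.IsPositive) :
    ∃ S : E →L[ℂ] E, S.IsPositive ∧ S * S = C :=
  ⟨CFC.sqrt C, (nonneg_iff_isPositive _).1 (CFC.sqrt_nonneg _),
    CFC.sqrt_mul_sqrt_self _ ((nonneg_iff_isPositive _).2 hC)⟩

/-- With `C = S²`, `‖C x‖ ≤ ‖S‖ ‖S x‖` and `‖S x‖²` is the form of `C`. Hence a zero of the form is
a zero of `C`. -/
theorem IsPositive.exists_norm_apply_sq_le {C : E →L[ℂ] E} (hC : C.IsPositive) :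
    ∃ k, 0 ≤ k ∧ ∀ x, ‖C x‖ ^ 2 ≤ k * C.reApplyInnerSelf x := by
  obtain ⟨S, hS, rfl⟩ := exists_sq_eq_of_isPositive hC
  refine ⟨‖S‖ ^ 2, by positivity, fun x => ?_⟩
  have h1 : (S * S).reApplyInnerSelf x = ‖S x‖ ^ 2 := by
    rw [S.apply_norm_sq_eq_inner_adjoint_left, hS.isSelfAdjoint.adjoint_eq]; rfl
  rw [h1, ← mul_pow]
  exact pow_le_pow_left₀ (norm_nonneg _) (S.le_opNorm _) 2

/-- The compression of `B` to a closed subspace. -/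
noncomputable def compression (M : Submodule ℂ E) [CompleteSpace M] (B : E →L[ℂ] E) : M →L[ℂ] M :=
  adjoint M.subtypeL ∘L B ∘L M.subtypeL

theorem inner_compression (M : Submodule ℂ E) [CompleteSpace M] (B : E →L[ℂ] E) (x y : M) :
    inner ℂ (compression M B x) y = inner ℂ (B x) (y : E) := by
  simp [compression, adjoint_inner_left]

theorem isPositive_compression (M : Submodule ℂ E) [CompleteSpace M] {B : E →L[ℂ] E}
    (hB : IsSelfAdjoint B) (h : ∀ x ∈ M, 0 ≤ B.reApplyInnerSelf x) :
    (compression M B).IsPositive := by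
  refine isPositive_def'.2 ⟨?_, fun x => ?_⟩
  · rw [isSelfAdjoint_iff']
    simp [compression, adjoint_comp, hB.adjoint_eq, comp_assoc]
  · rw [reApplyInnerSelf_apply, inner_compression]
    exact h x x.2

theorem inner_apply_eq_zero_of_isMin {B : E →L[ℂ] E} (hB : IsSelfAdjoint B) {M : Submodule ℂ E}
    (hM : IsClosed (M : Set E)) (h : ∀ x ∈ M, 0 ≤ B.reApplyInnerSelf x) {x₀ : E} (hx₀ : x₀ ∈ M)
    (h₀ : B.reApplyInnerSelf x₀ = 0) {y : E} (hy : y ∈ M) : inner ℂ (B x₀) y = 0 := by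
  have : CompleteSpace M := hM.completeSpace_coe
  obtain ⟨k, -, hk⟩ := IsPositive.exists_norm_apply_sq_le (isPositive_compression M hB h)
  have h1 := hk ⟨x₀, hx₀⟩
  have h2 : (compression M B).reApplyInnerSelf ⟨x₀, hx₀⟩ = 0 := by
    rw [reApplyInnerSelf_apply, inner_compression]; exact h₀
  rw [h2, mul_zero] at h1
  have h3 : compression M B ⟨x₀, hx₀⟩ = 0 := by
    have := le_antisymm h1 (sq_nonneg _)
    simpa using this
  have := inner_compression M B ⟨x₀, hx₀⟩ ⟨y, hy⟩
  rw [h3, inner_zero_left] at this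
  exact this.symm

/-! ### The diagonal obstruction to attainment. -/

theorem isSelfAdjoint_sub_smul_one {A : E →L[ℂ] E} (hA : IsSelfAdjoint A) (β : ℝ) :
    IsSelfAdjoint (A - (β : ℂ) • (1 : E →L[ℂ] E)) :=
  hA.sub (IsSelfAdjoint.smul (Complex.conj_ofReal β) (.one _))

/-- The quadratic form does not attain its minimum on the closed span of an orthonormal sequence
that diagonalizes it with strictly decreasing values. -/
theorem not_formAttaining_of_strictAnti {A : E →L[ℂ] E} (hA : IsSelfAdjoint A) {e : ℕ → E}
    (he : Orthonormal ℂ e) (hAe : ∀ i j, i ≠ j → inner ℂ (A (e i)) (e j) = 0)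
    (hlt : StrictAnti fun n => A.reApplyInnerSelf (e n)) : ¬ FormAttaining A := by
  intro hF
  set M := (Submodule.span ℂ (Set.range e)).topologicalClosure
  have hM : IsClosed (M : Set E) := Submodule.isClosed_topologicalClosure _
  have heM (n : ℕ) : e n ∈ M := Submodule.le_topologicalClosure _ (Submodule.subset_span ⟨n, rfl⟩)
  have hMbot : M ≠ ⊥ := M.ne_bot_iff.2 ⟨e 0, heM 0, he.ne_zero 0⟩
  have hext {v x : E} (hv : ∀ n, inner ℂ v (e n) = 0) (hx : x ∈ M) : inner ℂ v x = 0 := by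
    have h1 : M ≤ (ℂ ∙ v)ᗮ := by
      refine Submodule.topologicalClosure_minimal _ ?_ (Submodule.isClosed_orthogonal _)
      rw [Submodule.span_le]
      rintro _ ⟨n, rfl⟩
      exact Submodule.mem_orthogonal_singleton_iff_inner_right.2 (hv n)
    exact Submodule.mem_orthogonal_singleton_iff_inner_right.1 (h1 hx)
  obtain ⟨x₀, hx₀, h₀, hmin⟩ := hF M hM hMbot
  set μ := A.reApplyInnerSelf x₀
  set B := A - (μ : ℂ) • (1 : E →L[ℂ] E) with hBdef
  have hB : IsSelfAdjoint B := isSelfAdjoint_sub_smul_one hA μ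
  have hBnn (x : E) (hx : x ∈ M) : 0 ≤ B.reApplyInnerSelf x := by
    rw [reApplyInnerSelf_sub_smul_one, sub_nonneg]
    exact le_reApplyInnerSelf_of_unit hmin hx
  have hB0 : B.reApplyInnerSelf x₀ = 0 := by
    rw [reApplyInnerSelf_sub_smul_one, h₀]; simp [μ]
  have hcoef (n : ℕ) : inner ℂ x₀ (e n) = 0 := by
    have h1 := inner_apply_eq_zero_of_isMin hB hM hBnn hx₀ hB0 (heM n)
    rw [← adjoint_inner_right, hB.adjoint_eq] at h1
    set a := A.reApplyInnerSelf (e n) with ha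
    -- Strict decrease enters here: `μ` is at most the next diagonal value, which is below `a`.
    have hμa : μ < a := (hmin _ (heM (n + 1)) (he.1 _)).trans_lt (hlt n.lt_succ_self)
    -- Diagonality makes `e n` an eigenvector of the compression to `M` with eigenvalue `a`. As `x₀`
    -- has eigenvalue `μ ≠ a`, the two are orthogonal.
    have h2 : inner ℂ (A (e n) - (a : ℂ) • e n) x₀ = 0 := by
      refine hext (fun m => ?_) hx₀
      rw [inner_sub_left, inner_smul_left, Complex.conj_ofReal]
      rcases eq_or_ne n m with rfl | hnm
      · rw [inner_self_eq_norm_sq_to_K, he.1 n, ha]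
        have := (hA.isSymmetric).coe_reApplyInnerSelf_apply (e n)
        rw [← this]; simp
      · rw [hAe n m hnm, he.2 hnm]; simp
    have h3 : inner ℂ x₀ (A (e n)) = (a : ℂ) * inner ℂ x₀ (e n) := by
      have := congrArg (starRingEnd ℂ) h2
      rwa [inner_conj_symm, inner_sub_right, inner_smul_right, map_zero, sub_eq_zero] at this
    rw [hBdef] at h1
    simp only [sub_apply, smul_apply, one_apply_eq_self, inner_sub_right, inner_smul_right, h3,
      ← sub_mul, mul_eq_zero] at h1
    refine h1.resolve_left ?_
    rw [← Complex.ofReal_sub, Complex.ofReal_eq_zero]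
    exact (sub_pos.2 hμa).ne'
  have := hext hcoef hx₀
  rw [inner_self_eq_zero] at this
  simp [this] at h₀

/-! ### Compactness and sufficiency of the criterion. -/

theorem isCompactOperator_starProjection {F : Type*} [NormedAddCommGroup F]
    [InnerProductSpace ℂ F] (W : Submodule ℂ F) [FiniteDimensional ℂ W] :
    IsCompactOperator W.starProjection := by
  have : ProperSpace W := FiniteDimensional.proper_rclike ℂ W
  exact (isCompactOperator_of_locallyCompactSpace_dom W.orthogonalProjectionOnto).clm_comp W.subtypeL

theorem IsPositive.norm_le_of_reApplyInnerSelf_le {C : E →L[ℂ] E} (hC : C.IsPositive) {ε : ℝ}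
    (hε : 0 ≤ ε) (h : ∀ x, C.reApplyInnerSelf x ≤ ε * ‖x‖ ^ 2) : ‖C‖ ≤ ε := by
  obtain ⟨S, hS, rfl⟩ := exists_sq_eq_of_isPositive hC
  have hS1 : ‖S‖ ≤ √ε := by
    refine opNorm_le_bound _ (Real.sqrt_nonneg _) fun x => ?_
    have h1 : (S * S).reApplyInnerSelf x = ‖S x‖ ^ 2 := by
      rw [S.apply_norm_sq_eq_inner_adjoint_left, hS.isSelfAdjoint.adjoint_eq]; rfl
    have h2 := h x
    rw [h1] at h2
    refine (sq_le_sq₀ (norm_nonneg _) (by positivity)).1 ?_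
    rwa [mul_pow, Real.sq_sqrt hε]
  calc ‖S * S‖ ≤ ‖S‖ * ‖S‖ := norm_mul_le _ _
    _ ≤ √ε * √ε := by gcongr
    _ = ε := Real.mul_self_sqrt hε

/-- A self-adjoint operator whose quadratic form is small on subspaces of finite codimension is
compact. -/
theorem isCompactOperator_of_forall_exists_small {D : E →L[ℂ] E} (hD : IsSelfAdjoint D)
    (h : ∀ ε > 0, ∃ W : Submodule ℂ E, FiniteDimensional ℂ W ∧
      ∀ x ∈ Wᗮ, -(ε * ‖x‖ ^ 2) ≤ D.reApplyInnerSelf x ∧ D.reApplyInnerSelf x ≤ 0) :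
    IsCompactOperator D := by
  have hcl : IsClosed {f : E →L[ℂ] E | IsCompactOperator f} := isClosed_setOfPred_isCompactOperator
  refine hcl.closure_subset (Metric.mem_closure_iff.2 fun ε hε => ?_)
  obtain ⟨W, hW, hWD⟩ := h (ε / 2) (half_pos hε)
  set P := W.starProjection
  have hP : IsCompactOperator P := isCompactOperator_starProjection W
  set Q := Wᗮ.starProjection
  have hQ : Q = 1 - P := Submodule.starProjection_orthogonal' W
  have hQs (x y : E) : inner ℂ (Q x) y = inner ℂ x (Q y) :=
    Submodule.inner_starProjection_left_eq_right _ x y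
  have hQm (x : E) : Q x ∈ Wᗮ := Submodule.starProjection_apply_mem _ x
  have hq (x : E) : (-(Q * D * Q)).reApplyInnerSelf x = -D.reApplyInnerSelf (Q x) := by
    simp [reApplyInnerSelf_apply, hQs]
  have hpos : (-(Q * D * Q)).IsPositive := by
    refine isPositive_def'.2 ⟨?_, fun x => ?_⟩
    · have hQsa : IsSelfAdjoint Q := isSelfAdjoint_starProjection _
      have := hD.conjugate_self hQsa
      exact this.neg
    · rw [hq]; linarith [(hWD _ (hQm x)).2]
  -- Every term of this difference contains the finite-rank `P`, so it is compact; it differs from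
  -- `D` by `Q * D * Q`, whose norm is at most `ε / 2`.
  refine ⟨D - Q * D * Q, ?_, ?_⟩
  · have : D - Q * D * Q = P * D + (1 - P) * D * P := by rw [hQ]; noncomm_ring
    have h1 : IsCompactOperator (P * D : E →L[ℂ] E) := hP.comp_clm D
    have h2 : IsCompactOperator ((1 - P) * D * P : E →L[ℂ] E) := by
      rw [mul_def, coe_comp]
      exact hP.clm_comp ((1 - P) * D)
    rw [Set.mem_ofPred_eq, this]
    exact h1.add h2
  · have hn : ‖-(Q * D * Q)‖ ≤ ε / 2 := by
      refine IsPositive.norm_le_of_reApplyInnerSelf_le hpos (half_pos hε).le fun x => ?_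
      rw [hq]
      have h1 := (hWD _ (hQm x)).1
      have h2 : ‖Q x‖ ≤ ‖x‖ := Submodule.norm_starProjection_apply_le _ _
      have h3 : ε / 2 * ‖Q x‖ ^ 2 ≤ ε / 2 * ‖x‖ ^ 2 := by gcongr
      linarith
    rw [norm_neg] at hn
    rw [dist_eq_norm, sub_sub_cancel]
    linarith

/-- A positive compact perturbation of a nonzero scalar is bounded below or has a kernel. -/
theorem exists_unit_apply_eq_zero {C : E →L[ℂ] E} (hC : C.IsPositive) {γ : ℝ} (hγ : γ ≠ 0)
    (hK : IsCompactOperator (C - (γ : ℂ) • (1 : E →L[ℂ] E)))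
    (hinf : ∀ ε > 0, ∃ x, ‖x‖ = 1 ∧ C.reApplyInnerSelf x < ε) : ∃ x, ‖x‖ = 1 ∧ C x = 0 := by
  by_cases hev : End.HasEigenvalue ((C - (γ : ℂ) • (1 : E →L[ℂ] E) : E →L[ℂ] E) : End ℂ E) (-γ)
  · obtain ⟨v, hv⟩ := hev.exists_hasEigenvector
    have h1 := hv.apply_eq_smul
    have h2 : C v = 0 := by
      simpa [sub_eq_iff_eq_add] using h1
    exact ⟨((‖v‖⁻¹ : ℝ) : ℂ) • v, by simp [norm_smul, hv.2], by simp [h2]⟩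
  · exfalso
    -- Fredholm alternative: if `-γ` is not an eigenvalue of `C - γ`, then `C` is bounded below.
    obtain ⟨K, hK⟩  := IsCompactOperator.antilipschitz_of_not_hasEigenvalue hK
      (neg_ne_zero.2 (Complex.ofReal_ne_zero.2 hγ)) hev
    obtain ⟨k, hk0, hk⟩ := IsPositive.exists_norm_apply_sq_le hC
    have hbound (x : E) : ‖x‖ ≤ K * ‖C x‖ := by
      have := hK.le_mul_dist x 0
      simpa using this
    -- This `ε` forces `K² k ⟨C x, x⟩ < 1`, against `1 ≤ K² ‖C x‖²`; the `+ 1` avoids division by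
    -- zero.
    obtain ⟨x, hx, hxε⟩ := hinf (1 / (K ^ 2 * k + 1)) (by positivity)
    have h1 := hbound x
    rw [hx] at h1
    have h2 : 1 ≤ (K : ℝ) ^ 2 * ‖C x‖ ^ 2 := by
      rw [← mul_pow]; exact one_le_pow₀ h1
    have h3 : (K : ℝ) ^ 2 * ‖C x‖ ^ 2 ≤ K ^ 2 * (k * C.reApplyInnerSelf x) := by
      gcongr; exact hk x
    have h4 : (K : ℝ) ^ 2 * k * C.reApplyInnerSelf x ≤ K ^ 2 * k * (1 / (K ^ 2 * k + 1)) := by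
      gcongr
    have h5 : (K : ℝ) ^ 2 * k * (1 / (K ^ 2 * k + 1)) < 1 := by
      rw [mul_one_div, div_lt_one (by positivity)]; linarith
    linarith

/-- If the infimum `m` on `M` is below `β`, the compression of `A - m` is positive and a compact
perturbation of `β - m > 0`, so its kernel provides a minimizer. If `m ≥ β`, any unit vector of `M ⊓
Wᗮ` is a minimizer; when there is none, `M` embeds in `W` and its sphere is compact. -/
theorem IsEssScalarFromBelow.formAttaining {A : E →L[ℂ] E} (hA : IsSelfAdjoint A) {β : ℝ}
    (h : IsEssScalarFromBelow A β) : FormAttaining A := by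
  obtain ⟨hcpt, W, hW, hWA⟩ := h
  intro M hM hMbot
  have : CompleteSpace M := hM.completeSpace_coe
  obtain ⟨u, huM, hu⟩ := exists_unit_mem hMbot
  set s : Set ℝ := A.reApplyInnerSelf '' {x | x ∈ M ∧ ‖x‖ = 1}
  have hsne : s.Nonempty := ⟨_, u, ⟨huM, hu⟩, rfl⟩
  have hsb : BddBelow s := by
    refine ⟨-‖A‖, ?_⟩
    rintro _ ⟨x, ⟨-, hx⟩, rfl⟩
    have := neg_le_of_abs_le (norm_reApplyInnerSelf_le A x)
    simpa [hx] using this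
  have hle (x : E) (hx : x ∈ M) (hx1 : ‖x‖ = 1) : sInf s ≤ A.reApplyInnerSelf x :=
    csInf_le hsb ⟨x, ⟨hx, hx1⟩, rfl⟩
  rcases lt_or_ge (sInf s) β with hlt | hge
  · set m := sInf s
    set B := A - (m : ℂ) • (1 : E →L[ℂ] E) with hBdef
    have hB : IsSelfAdjoint B := isSelfAdjoint_sub_smul_one hA m
    have hBq (x : M) : (compression M B).reApplyInnerSelf x
        = A.reApplyInnerSelf x - m * ‖(x : E)‖ ^ 2 := by
      rw [reApplyInnerSelf_apply, inner_compression, ← reApplyInnerSelf_apply,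
        reApplyInnerSelf_sub_smul_one]
    have hpos : (compression M B).IsPositive := by
      refine isPositive_compression M hB fun x hx => ?_
      rw [reApplyInnerSelf_sub_smul_one, sub_nonneg]
      exact le_reApplyInnerSelf_of_unit hle hx
    have hK : IsCompactOperator (compression M B - ((β - m : ℝ) : ℂ) • (1 : M →L[ℂ] M)) := by
      have h1 : compression M B - ((β - m : ℝ) : ℂ) • (1 : M →L[ℂ] M) =
          adjoint M.subtypeL ∘L (A - (β : ℂ) • (1 : E →L[ℂ] E)) ∘L M.subtypeL := by
        refine ContinuousLinearMap.ext fun x => ext_inner_right ℂ fun y => ?_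
        rw [sub_apply, inner_sub_left, inner_compression, comp_apply, adjoint_inner_left]
        simp [hBdef, inner_sub_left, inner_smul_left, -Complex.coe_smul]
        ring
      rw [h1]
      exact (hcpt.comp_clm M.subtypeL).clm_comp (adjoint M.subtypeL)
    obtain ⟨x, hx, hx0⟩ := exists_unit_apply_eq_zero hpos (sub_pos.2 hlt).ne' hK fun ε hε => by
      obtain ⟨_, ⟨x, ⟨hxM, hx1⟩, rfl⟩, hxlt⟩ := exists_lt_of_csInf_lt hsne (lt_add_of_pos_right m hε)
      refine ⟨⟨x, hxM⟩, hx1, ?_⟩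
      rw [hBq]
      simp only [hx1]
      linarith
    refine ⟨x, x.2, hx, fun y hy hy1 => ?_⟩
    have h2 := hBq x
    rw [reApplyInnerSelf_apply, hx0, inner_zero_left, map_zero] at h2
    have h3 : ‖(x : E)‖ = 1 := hx
    rw [h3] at h2
    linarith [hle y hy hy1]
  · by_cases hint : M ⊓ Wᗮ = ⊥
    · have hfin : FiniteDimensional ℂ M := by
        refine FiniteDimensional.of_injective
          ((W.orthogonalProjectionOnto : E →ₗ[ℂ] W) ∘ₗ M.subtype) ?_
        rw [← LinearMap.ker_eq_bot, LinearMap.ker_eq_bot']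
        intro x hx
        have h1 : (x : E) ∈ Wᗮ := Submodule.orthogonalProjectionOnto_eq_zero_iff.1 hx
        have h2 : (x : E) ∈ M ⊓ Wᗮ := ⟨x.2, h1⟩
        rw [hint] at h2
        simpa using h2
      have : ProperSpace M := FiniteDimensional.proper_rclike ℂ M
      obtain ⟨x, hx, hmin⟩ := (isCompact_sphere (0 : M) 1).exists_isMinOn ⟨⟨u, huM⟩, by simpa using hu⟩
        (A.reApplyInnerSelf_continuous.comp continuous_subtype_val).continuousOn
      exact ⟨x, x.2, by simpa using hx, fun y hy hy1 =>
        hmin (show (⟨y, hy⟩ : M) ∈ Metric.sphere 0 1 by simpa using hy1)⟩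
    · obtain ⟨x, ⟨hxM, hxW⟩, hx1⟩ := exists_unit_mem hint
      refine ⟨x, hxM, hx1, fun y hy hy1 => ?_⟩
      have h1 := hWA x hxW
      rw [reApplyInnerSelf_sub_smul_one, hx1] at h1
      linarith [hle y hy hy1]

/-! ### Necessity of the criterion. -/

/-- If the form takes values above and arbitrarily close to or below `β` on every subspace of
finite codimension, then it does not attain its minimum on some closed subspace. -/
theorem not_formAttaining_of_forall_finiteDimensional {A : E →L[ℂ] E} (hA : IsSelfAdjoint A) {β : ℝ}
    (h : ∀ W : Submodule ℂ E, FiniteDimensional ℂ W →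
      (∃ x ∈ Wᗮ, ‖x‖ = 1 ∧ β < A.reApplyInnerSelf x) ∧
      ∀ c > β, ∃ x ∈ Wᗮ, ‖x‖ = 1 ∧ A.reApplyInnerSelf x < c) : ¬ FormAttaining A := by
  obtain ⟨e, he, hr⟩ := exists_seq_of_forall_finset_exists
    (fun x : E => ‖x‖ = 1 ∧ β < A.reApplyInnerSelf x)
    (fun x y => (inner ℂ x y = 0 ∧ inner ℂ (A x) y = 0) ∧
      A.reApplyInnerSelf y < A.reApplyInnerSelf x) fun s hs => by
    classical
    -- Orthogonality to the earlier vectors and to their images under `A` gives orthonormality and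
    -- diagonality together.
    set W := Submodule.span ℂ ((s ∪ s.image A : Finset E) : Set E)
    have hWperp {x z : E} (hx : x ∈ s) (hz : z ∈ Wᗮ) : inner ℂ x z = 0 ∧ inner ℂ (A x) z = 0 := by
      refine ⟨(Submodule.mem_orthogonal _ _).1 hz _ (Submodule.subset_span ?_),
        (Submodule.mem_orthogonal _ _).1 hz _ (Submodule.subset_span ?_)⟩
      · simp [hx]
      · simp only [Finset.coe_union, Finset.coe_image]
        exact Or.inr ⟨x, hx, rfl⟩
    obtain ⟨⟨y, hyW, hy1, hyβ⟩, hlow⟩ := h W (FiniteDimensional.span_finset ℂ _)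
    obtain ⟨z, hz, hzmin⟩ := (insert y s).exists_min_image A.reApplyInnerSelf ⟨y, by simp⟩
    have hzβ : β < A.reApplyInnerSelf z := by
      rcases Finset.mem_insert.1 hz with rfl | hz
      · exact hyβ
      · exact (hs z hz).2
    -- The next vector takes the exact value `c`, above `β` and below all earlier values, so the
    -- recursion can continue.
    obtain ⟨c, hβc, hcz⟩ := exists_between hzβ
    obtain ⟨x, hxW, hx1, hxc⟩ := hlow c hβc
    obtain ⟨w, hwW, hw1, hwc⟩ := exists_unit_reApplyInnerSelf_eq A hxW hyW hx1 hy1 hxc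
      (hcz.trans_le (hzmin y (by simp)))
    exact ⟨w, ⟨hw1, hwc ▸ hβc⟩, fun v hv => ⟨hWperp hv hwW,
      hwc ▸ hcz.trans_le (hzmin v (Finset.mem_insert_of_mem hv))⟩⟩
  refine not_formAttaining_of_strictAnti hA (e := e) ⟨fun n => (he n).1, fun i j hij => ?_⟩
    (fun i j hij => ?_) fun i j hij => (hr i j hij).2
  · rcases lt_or_gt_of_ne hij with hlt | hlt
    · exact (hr i j hlt).1.1
    · exact inner_eq_zero_symm.1 (hr j i hlt).1.1
  · rcases lt_or_gt_of_ne hij with hlt | hlt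
    · exact (hr i j hlt).1.2
    · have := (hr j i hlt).1.2
      rw [← adjoint_inner_right, hA.adjoint_eq] at this
      exact inner_eq_zero_symm.1 this

/-- The witness `β` is the supremum, over finite-dimensional `W`, of the infimum of the form on the
unit sphere of `Wᗮ`. If the form exceeded `β` on every `Wᗮ`, the diagonal sequence could be built.
-/
theorem FormAttaining.exists_isEssScalarFromBelow {A : E →L[ℂ] E} (hA : A.IsPositive)
    (h : FormAttaining A) : ∃ β, 0 ≤ β ∧ IsEssScalarFromBelow A β := by
  have hAsa := hA.isSelfAdjoint
  have hnn (x : E) : 0 ≤ A.reApplyInnerSelf x := hA.re_inner_nonneg_left x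
  let sph : Submodule ℂ E → Set ℝ := fun W => A.reApplyInnerSelf '' {x | x ∈ Wᗮ ∧ ‖x‖ = 1}
  have hsphb (W : Submodule ℂ E) : BddBelow (sph W) :=
    ⟨0, by rintro _ ⟨x, -, rfl⟩; exact hnn x⟩
  have hle (W : Submodule ℂ E) {x : E} (hx : x ∈ Wᗮ) (hx1 : ‖x‖ = 1) :
      sInf (sph W) ≤ A.reApplyInnerSelf x := csInf_le (hsphb W) ⟨x, ⟨hx, hx1⟩, rfl⟩
  have hnorm {x : E} (hx1 : ‖x‖ = 1) : A.reApplyInnerSelf x ≤ ‖A‖ := by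
    have := le_of_abs_le (norm_reApplyInnerSelf_le A x)
    simpa [hx1] using this
  let S : Set ℝ := (fun W => sInf (sph W)) '' {W : Submodule ℂ E | FiniteDimensional ℂ W}
  have hSb : BddAbove S := by
    refine ⟨‖A‖, ?_⟩
    rintro _ ⟨W, -, rfl⟩
    rcases (sph W).eq_empty_or_nonempty with he | ⟨_, x, hx, rfl⟩
    -- Without unit vectors in `Wᗮ` the infimum takes the default value `0`.
    · simp [he]
    · exact (hle W hx.1 hx.2).trans (hnorm hx.2)
  have hSne : S.Nonempty := ⟨_, ⊥, inferInstanceAs (FiniteDimensional ℂ (⊥ : Submodule ℂ E)), rfl⟩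
  set β := sSup S
  have hβ0 : 0 ≤ β := by
    refine Real.sSup_nonneg ?_
    rintro _ ⟨W, -, rfl⟩
    refine Real.sInf_nonneg ?_
    rintro _ ⟨x, -, rfl⟩
    exact hnn x
  have hW₀ : ∃ W : Submodule ℂ E, FiniteDimensional ℂ W ∧
      ∀ x ∈ Wᗮ, ‖x‖ = 1 → A.reApplyInnerSelf x ≤ β := by
    by_contra! hcon
    refine not_formAttaining_of_forall_finiteDimensional hAsa (β := β) (fun W hW => ?_) h
    obtain ⟨x, hx, hx1, hxβ⟩ := hcon W hW
    refine ⟨⟨x, hx, hx1, hxβ⟩, fun c hc => ?_⟩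
    have h1 : sInf (sph W) < c := (le_csSup hSb ⟨W, hW, rfl⟩).trans_lt hc
    obtain ⟨_, ⟨y, hy, rfl⟩, hyc⟩ := exists_lt_of_csInf_lt
      (show (sph W).Nonempty from ⟨_, x, ⟨hx, hx1⟩, rfl⟩) h1
    exact ⟨y, hy.1, hy.2, hyc⟩
  obtain ⟨W₀, hfin₀, hW₀⟩ := hW₀
  have hW₀' (x : E) (hx : x ∈ W₀ᗮ) : (A - (β : ℂ) • (1 : E →L[ℂ] E)).reApplyInnerSelf x ≤ 0 := by
    rw [reApplyInnerSelf_sub_smul_one, sub_nonpos]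
    exact reApplyInnerSelf_le_of_unit hW₀ hx
  refine ⟨β, hβ0, ?_, W₀, hfin₀, hW₀'⟩
  refine isCompactOperator_of_forall_exists_small (isSelfAdjoint_sub_smul_one hAsa β) fun ε hε => ?_
  obtain ⟨_, ⟨W₁, hfin₁, rfl⟩, hW₁⟩ := exists_lt_of_lt_csSup hSne (sub_lt_self β hε)
  have : FiniteDimensional ℂ W₁ := hfin₁
  -- `W₀` gives the upper bound `0`, and `W₁`, nearly optimal in the supremum, the lower bound `-ε`.
  refine ⟨W₀ ⊔ W₁, inferInstance, fun x hx => ?_⟩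
  refine ⟨?_, hW₀' x (Submodule.orthogonal_le le_sup_left hx)⟩
  have h1 := le_reApplyInnerSelf_of_unit (A := A) (M := W₁ᗮ) (m := β - ε)
    (fun y hy hy1 => hW₁.le.trans (hle W₁ hy hy1)) (Submodule.orthogonal_le le_sup_right hx)
  rw [reApplyInnerSelf_sub_smul_one]
  linarith

theorem formAttaining_iff_exists_isEssScalarFromBelow {A : E →L[ℂ] E} (hA : A.IsPositive) :
    FormAttaining A ↔ ∃ β, 0 ≤ β ∧ IsEssScalarFromBelow A β :=
  ⟨fun h => h.exists_isEssScalarFromBelow hA, fun ⟨_, _, h⟩ => h.formAttaining hA.isSelfAdjoint⟩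

/-! ### Stability of the criterion under squaring and square roots. -/

/-- Negativity of a quadratic form on a subspace of finite codimension is preserved by
conjugation. -/
theorem exists_conj_reApplyInnerSelf_nonpos {D S : E →L[ℂ] E} (hS : IsSelfAdjoint S)
    {W : Submodule ℂ E} (hW : FiniteDimensional ℂ W) (h : ∀ x ∈ Wᗮ, D.reApplyInnerSelf x ≤ 0) :
    ∃ W' : Submodule ℂ E, FiniteDimensional ℂ W' ∧
      ∀ x ∈ W'ᗮ, (S * D * S).reApplyInnerSelf x ≤ 0 := by
  -- For self-adjoint `S`, `x ⊥ S W` means `S x ⊥ W`.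
  refine ⟨W.map (S : E →ₗ[ℂ] E), inferInstance, fun x hx => ?_⟩
  have hsym (u v : E) : inner ℂ (S u) v = inner ℂ u (S v) := hS.isSymmetric u v
  have hSx : S x ∈ Wᗮ := (Submodule.mem_orthogonal _ _).2 fun w hw => by
    rw [← hsym]
    exact (Submodule.mem_orthogonal _ _).1 hx _ (Submodule.mem_map_of_mem hw)
  have : (S * D * S).reApplyInnerSelf x = D.reApplyInnerSelf (S x) := by
    simp [reApplyInnerSelf_apply, hsym]
  rw [this]
  exact h _ hSx

theorem isPositive_add_smul_one {F : Type*} [NormedAddCommGroup F] [InnerProductSpace ℂ F]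
    {A : F →L[ℂ] F} (hA : A.IsPositive) {β : ℝ} (hβ : 0 ≤ β) :
    (A + (β : ℂ) • (1 : F →L[ℂ] F)).IsPositive :=
  hA.add (isPositive_one.smul_of_nonneg (by exact_mod_cast hβ))

theorem commute_sqrt_add_smul_one_sub_smul_one (A : E →L[ℂ] E) (β : ℝ) :
    Commute (CFC.sqrt (A + (β : ℂ) • (1 : E →L[ℂ] E))) (A - (β : ℂ) • (1 : E →L[ℂ] E)) := by
  refine Commute.cfcₙ_nnreal (Commute.add_left ?_ ?_) _
  · exact (Commute.refl A).sub_right ((Commute.one_right A).smul_right _)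
  · exact (Commute.one_left _).smul_left _

theorem mul_self_sub_smul_one {F : Type*} [NormedAddCommGroup F] [InnerProductSpace ℂ F]
    (A : F →L[ℂ] F) (β : ℝ) :
    A * A - ((β ^ 2 : ℝ) : ℂ) • (1 : F →L[ℂ] F) =
      (A - (β : ℂ) • (1 : F →L[ℂ] F)) * (A + (β : ℂ) • (1 : F →L[ℂ] F)) := by
  have h1 : ((β : ℂ) • (1 : F →L[ℂ] F)) * (A + (β : ℂ) • (1 : F →L[ℂ] F)) =
      (β : ℂ) • A + ((β ^ 2 : ℝ) : ℂ) • (1 : F →L[ℂ] F) := by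
    rw [smul_mul_assoc, one_mul, smul_add, smul_smul, Complex.ofReal_pow, sq]
  have h2 : A * (A + (β : ℂ) • (1 : F →L[ℂ] F)) = A * A + (β : ℂ) • A := by
    rw [mul_add, mul_smul_comm, mul_one]
  rw [sub_mul, h1, h2]
  abel

theorem IsEssScalarFromBelow.mul_self {A : E →L[ℂ] E} (hA : A.IsPositive) {β : ℝ} (hβ : 0 ≤ β)
    (h : IsEssScalarFromBelow A β) : IsEssScalarFromBelow (A * A) (β ^ 2) := by
  obtain ⟨hcpt, W, hW, hWA⟩ := h
  set D := A - (β : ℂ) • (1 : E →L[ℂ] E)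
  set R := A + (β : ℂ) • (1 : E →L[ℂ] E) with hR
  have hRpos : 0 ≤ R := (nonneg_iff_isPositive _).2 (isPositive_add_smul_one hA hβ)
  have hS : Commute (CFC.sqrt R) D := commute_sqrt_add_smul_one_sub_smul_one A β
  have key : D * R = CFC.sqrt R * D * CFC.sqrt R := by
    rw [hS.eq, mul_assoc, CFC.sqrt_mul_sqrt_self R hRpos]
  rw [IsEssScalarFromBelow, mul_self_sub_smul_one]
  refine ⟨hcpt.comp_clm R, ?_⟩
  rw [key]
  exact exists_conj_reApplyInnerSelf_nonpos
    ((nonneg_iff_isPositive _).1 (CFC.sqrt_nonneg R)).isSelfAdjoint hW hWA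

/-- For `β > 0`, `A + β ≥ β` is invertible, so the conjugation by its square root can be undone. -/
theorem IsEssScalarFromBelow.of_mul_self {A : E →L[ℂ] E} (hA : A.IsPositive) {β : ℝ} (hβ : 0 < β)
    (h : IsEssScalarFromBelow (A * A) (β ^ 2)) : IsEssScalarFromBelow A β := by
  rw [IsEssScalarFromBelow, mul_self_sub_smul_one] at h
  obtain ⟨hcpt, W, hW, hWA⟩ := h
  set D := A - (β : ℂ) • (1 : E →L[ℂ] E)
  set R := A + (β : ℂ) • (1 : E →L[ℂ] E) with hR
  have hRpos : 0 ≤ R := (nonneg_iff_isPositive _).2 (isPositive_add_smul_one hA hβ.le)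
  have hunit : IsUnit R := by
    refine isUnit_of_forall_le_norm_inner_map R (c := ⟨β, hβ.le⟩) hβ fun x => ?_
    have h1 : β * ‖x‖ ^ 2 ≤ R.reApplyInnerSelf x := by
      have := reApplyInnerSelf_sub_smul_one A (-β) x
      have h2 : A - ((-β : ℝ) : ℂ) • (1 : E →L[ℂ] E) = R := by simp [hR]
      rw [h2] at this
      have h3 : 0 ≤ A.reApplyInnerSelf x := hA.re_inner_nonneg_left x
      linarith
    calc ‖x‖ ^ 2 * β = β * ‖x‖ ^ 2 := mul_comm _ _
      _ ≤ R.reApplyInnerSelf x := h1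
      _ ≤ ‖inner ℂ (R x) x‖ := RCLike.re_le_norm _
  obtain ⟨V, hV⟩ : IsUnit (CFC.sqrt R) := (CFC.isUnit_sqrt_iff R hRpos).2 hunit
  have hS : Commute (V : E →L[ℂ] E) D := by
    rw [hV]
    exact commute_sqrt_add_smul_one_sub_smul_one A β
  have hVR : (V : E →L[ℂ] E) * V = R := by rw [hV, CFC.sqrt_mul_sqrt_self R hRpos]
  have hVsa : IsSelfAdjoint (V : E →L[ℂ] E) := by
    rw [hV]; exact ((nonneg_iff_isPositive _).1 (CFC.sqrt_nonneg R)).isSelfAdjoint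
  have hVinv : IsSelfAdjoint ((V⁻¹ : (E →L[ℂ] E)ˣ) : E →L[ℂ] E) := by
    have hstar : star V = V := Units.ext hVsa
    rw [IsSelfAdjoint, ← Units.coe_star, star_inv, hstar]
  have key : D = (V⁻¹ : (E →L[ℂ] E)ˣ) * (D * R) * (V⁻¹ : (E →L[ℂ] E)ˣ) := by
    have h1 : D * R = V * (D * V) := by
      rw [← hVR, ← mul_assoc, ← mul_assoc, hS.eq]
    rw [h1]
    simp [mul_assoc]
  refine ⟨?_, ?_⟩
  · have h1 : D = D * R * ((V⁻¹ * V⁻¹ : (E →L[ℂ] E)ˣ) : E →L[ℂ] E) := by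
      rw [← hVR]
      simp [mul_assoc]
    change IsCompactOperator D
    rw [h1]
    exact hcpt.comp_clm _
  · change ∃ W : Submodule ℂ E, FiniteDimensional ℂ W ∧ ∀ x ∈ Wᗮ, D.reApplyInnerSelf x ≤ 0
    rw [key]
    exact exists_conj_reApplyInnerSelf_nonpos hVinv hW hWA

/-- Here `A + β` need not be invertible. Instead `‖A x‖² ≤ 0` on `Wᗮ`, so `A` vanishes there and has
finite rank. -/
theorem IsEssScalarFromBelow.of_mul_self_zero {A : E →L[ℂ] E} (hA : A.IsPositive)
    (h : IsEssScalarFromBelow (A * A) 0) : IsEssScalarFromBelow A 0 := by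
  obtain ⟨-, W, hW, hWA⟩ := h
  have hzero (x : E) (hx : x ∈ Wᗮ) : A x = 0 := by
    have h1 := hWA x hx
    have h2 : (A * A).reApplyInnerSelf x = ‖A x‖ ^ 2 := by
      rw [A.apply_norm_sq_eq_inner_adjoint_left, hA.isSelfAdjoint.adjoint_eq]; rfl
    rw [reApplyInnerSelf_sub_smul_one, h2] at h1
    have h3 : ‖A x‖ ^ 2 = 0 := le_antisymm (by linarith) (sq_nonneg _)
    simpa using h3
  have hAP : A = A * W.starProjection := by
    ext x
    have := hzero _ (W.sub_starProjection_mem_orthogonal x)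
    rwa [map_sub, sub_eq_zero] at this
  refine ⟨?_, W, hW, fun x hx => ?_⟩
  · rw [Complex.ofReal_zero, zero_smul, sub_zero, hAP, mul_def, coe_comp]
    exact (isCompactOperator_starProjection W).clm_comp A
  · rw [reApplyInnerSelf_sub_smul_one, reApplyInnerSelf_apply, hzero x hx]
    simp

/-- A positive operator has a minimum attaining form on all closed subspaces if and only if its
square does. -/
theorem formAttaining_mul_self_iff {A : E →L[ℂ] E} (hA : A.IsPositive) :
    FormAttaining (A * A) ↔ FormAttaining A := by
  have hAA : (A * A).IsPositive := by
    have := isPositive_adjoint_comp_self A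
    rwa [hA.isSelfAdjoint.adjoint_eq] at this
  rw [formAttaining_iff_exists_isEssScalarFromBelow hAA,
    formAttaining_iff_exists_isEssScalarFromBelow hA]
  constructor
  · rintro ⟨β, hβ, h⟩
    rcases hβ.eq_or_lt with rfl | hβ
    · exact ⟨0, le_rfl, h.of_mul_self_zero hA⟩
    · rw [← Real.sq_sqrt hβ.le] at h
      exact ⟨√β, Real.sqrt_nonneg _, h.of_mul_self hA (Real.sqrt_pos.2 hβ)⟩
  · rintro ⟨β, hβ, h⟩
    exact ⟨β ^ 2, sq_nonneg _, h.mul_self hA hβ⟩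

end Hilbert

end AbsMin

theorem mainTheorem3 {H₁ H₂ : Type*}
    [NormedAddCommGroup H₁] [InnerProductSpace ℂ H₁] [CompleteSpace H₁]
    [NormedAddCommGroup H₂] [InnerProductSpace ℂ H₂] [CompleteSpace H₂]
    (T : H₁ →L[ℂ] H₂) :
    List.TFAE [
      T ∈ AbsMin.AM H₁ H₂,
      AbsMin.modulus T ∈ AbsMin.AMPlus H₁,
      ContinuousLinearMap.adjoint T ∘L T ∈ AbsMin.AMPlus H₁] := by
  have hA := ContinuousLinearMap.isPositive_adjoint_comp_self T
  obtain ⟨hmod, hsq⟩ := (AbsMin.eq_modulus_iff T _).1 rfl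
  have h1 : T ∈ AbsMin.AM H₁ H₂ ↔ AbsMin.FormAttaining (ContinuousLinearMap.adjoint T ∘L T) :=
    AbsMin.isAbsMinAttaining_iff_formAttaining T
  have h2 : AbsMin.modulus T ∈ AbsMin.AMPlus H₁ ↔
      AbsMin.FormAttaining (ContinuousLinearMap.adjoint T ∘L T) := by
    refine (and_iff_left hmod).trans ((AbsMin.isAbsMinAttaining_iff_formAttaining _).trans ?_)
    rw [hmod.isSelfAdjoint.adjoint_eq, hsq]
  have h3 : ContinuousLinearMap.adjoint T ∘L T ∈ AbsMin.AMPlus H₁ ↔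
      AbsMin.FormAttaining (ContinuousLinearMap.adjoint T ∘L T) := by
    refine (and_iff_left hA).trans ((AbsMin.isAbsMinAttaining_iff_formAttaining _).trans ?_)
    rw [hA.isSelfAdjoint.adjoint_eq]
    exact AbsMin.formAttaining_mul_self_iff hA
  tfae_have 1 ↔ 2 := h1.trans h2.symm
  tfae_have 1 ↔ 3 := h1.trans h3.symm
  tfae_finish
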